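/- Let $\mathbb K$ be a field, let $d\ge 0$ be an integer, and let $V$ be a vector space over $\mathbb K$ of dimension $d+1$. An element $A\in\mathrm{End}(V)$ is multiplicity-free if $V$ is spanned by the eigenspaces of $A$ and each eigenspace has dimension one; the primitive idempotent of $A$ corresponding to an eigenvalue is the element of $\mathrm{End}(V)$ that acts as the identity on the corresponding eigenspace and as zero on the other eigenspaces. A thin Hessenberg system (TH system) on $V$, of diameter $d$, is a sequence $\Phi=(A;\{E_i\}_{i=0}^d;A^*;\{E_i^*\}_{i=0}^d)$ such that * $A,A^*\in\mathrm{End}(V)$ are multiplicity-free; * $\{E_i\}_{i=0}^d$ is an ordering of the primitive idempotents of $A$, and $\{E_i^*\}_{i=0}^d$ is an ordering of the primitive idempotents of $A^*$; * for $0\le i,j\le d$, both $E_iA^*E_j$ and $E_i^*AE_j^*$ are zero if $i-j>1$ and nonzero if $i-j=1$. The reduction of $\Phi$ is the sequence $(\{E_i\}_{i=0}^d;\{E_i^*\}_{i=0}^d)$. A reduced TH system (RTH system) on $V$, of diameter $d$, is a sequence $(\{E_i\}_{i=0}^d;\{E_i^*\}_{i=0}^d)$ for which there exist $A,A^*\in\mathrm{End}(V)$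 such that $(A;\{E_i\}_{i=0}^d;A^*;\{E_i^*\}_{i=0}^d)$ is a TH system on $V$. A TH system (RTH system) over $\mathbb K$ is a TH system (RTH system) on some vector space over $\mathbb K$. Two TH systems (respectively RTH systems) of diameter $d$, on $V$ and $W$, are isomorphic if there is a $\mathbb K$-algebra isomorphism $\mathrm{End}(V)\to\mathrm{End}(W)$ that carries each component of the first to the corresponding component of the second. An affine transformation of $\Phi$ is a TH system $(\alpha A+\beta I;\{E_i\}_{i=0}^d;\alpha^*A^*+\beta^*I;\{E_i^*\}_{i=0}^d)$ with $\alpha,\beta,\alpha^*,\beta^*\in\mathbb K$ and $\alpha,\alpha^*$ nonzero. TH systems $\Phi,\Phi'$ are affine isomorphic if $\Phi$ is isomorphic to an affine transformation of $\Phi'$; this is an equivalence relation. Then: 1. For all TH systems $\Phi$ and $\Phi'$ over $\mathbb K$ of diameter $d$, the reduction of $\Phi$ is isomorphic to the reduction of $\Phi'$ if and only if $\Phi$ is affine isomorphic to $\Phi'$. 2. The map that sends a TH system to its reduction induces a bijection from the set of affine isomorphism classes of TH systems over $\mathbb K$ of diameter $d$ to the set of isomorphism classes of RTH systems over $\mathbb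 K$ of diameter $d$. -/

import Mathlib

universe u v w

namespace ThinHessenberg

section Basic

variable {K : Type u} {V : Type v} [Field K] [AddCommGroup V] [Module K V]

/-- `A` is multiplicity-free: `V` is spanned by the eigenspaces of `A` (that is, `A` is
diagonalizable) and every eigenspace of `A` has dimension one. -/
def MultiplicityFree (A : Module.End K V) : Prop :=
  (⨆ μ : K, A.eigenspace μ) = ⊤ ∧
    ∀ μ : K, A.HasEigenvalue μ → Module.finrank K (A.eigenspace μ) = 1

/-- `F` is the identity on the `μ`-eigenspace of `A` and vanishes on all the other eigenspaces.
For `A` diagonalizable and `μ` an eigenvalue of `A`, this says that `F` is the primitive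
idempotent of `A` corresponding to `μ`. -/
def IsPrimitiveIdempotent (A : Module.End K V) (μ : K) (F : Module.End K V) : Prop :=
  (∀ x ∈ A.eigenspace μ, F x = x) ∧
    ∀ ν : K, ν ≠ μ → ∀ x ∈ A.eigenspace ν, F x = 0

/-- `E 0, …, E d` is an ordering of the primitive idempotents of `A`: there is an ordering
`θ 0, …, θ d`, without repetitions, of the eigenvalues of `A` such that `E i` is the primitive
idempotent of `A` corresponding to `θ i`. -/
def IsIdempotentOrdering {d : ℕ} (A : Module.End K V) (E : Fin (d + 1) → Module.End K V) : Prop :=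
  ∃ θ : Fin (d + 1) → K, Function.Injective θ ∧
    (∀ μ : K, A.HasEigenvalue μ ↔ ∃ i, θ i = μ) ∧
    ∀ i, IsPrimitiveIdempotent A (θ i) (E i)

/-- `E i * B * E j` is zero if `i - j > 1` and nonzero if `i - j = 1`. -/
def HessenbergWrt {d : ℕ} (E : Fin (d + 1) → Module.End K V) (B : Module.End K V) : Prop :=
  ∀ i j : Fin (d + 1),
    ((j : ℕ) + 1 < (i : ℕ) → E i * B * E j = 0) ∧
    ((i : ℕ) = (j : ℕ) + 1 → E i * B * E j ≠ 0)

/-- `(A; {E i}; A'; {E' i})` is a thin Hessenberg system on `V` of diameter `d`; here `A'`, `E'`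
stand for the usual `A^*`, `E^*`. -/
structure IsTHSystem {d : ℕ} (A : Module.End K V) (E : Fin (d + 1) → Module.End K V)
    (A' : Module.End K V) (E' : Fin (d + 1) → Module.End K V) : Prop where
  finrank_eq : Module.finrank K V = d + 1
  multiplicityFree : MultiplicityFree A
  multiplicityFree' : MultiplicityFree A'
  ordering : IsIdempotentOrdering A E
  ordering' : IsIdempotentOrdering A' E'
  hessenberg : HessenbergWrt E A'
  hessenberg' : HessenbergWrt E' A

end Basic

/-- TH systems on the `K`-vector space `V`, of diameter `d`. -/
structure THSystem (K : Type u) (V : Type v) [Field K] [AddCommGroup V] [Module K V] (d : ℕ) where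
  A : Module.End K V
  E : Fin (d + 1) → Module.End K V
  A' : Module.End K V
  E' : Fin (d + 1) → Module.End K V
  isTHSystem : IsTHSystem A E A' E'

/-- Reduced TH systems (RTH systems) on the `K`-vector space `V`, of diameter `d`. -/
structure RTHSystem (K : Type u) (V : Type v) [Field K] [AddCommGroup V] [Module K V] (d : ℕ) where
  E : Fin (d + 1) → Module.End K V
  E' : Fin (d + 1) → Module.End K V
  exists_isTHSystem : ∃ A A' : Module.End K V, IsTHSystem A E A' E'

section Affine

variable {K : Type u} {V : Type v} [Field K] [AddCommGroup V] [Module K V]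

theorem mem_eigenspace_affine (A : Module.End K V) {a : K} (ha : a ≠ 0) (b μ : K) (x : V) :
    x ∈ (a • A + b • (1 : Module.End K V)).eigenspace μ ↔
      x ∈ A.eigenspace (a⁻¹ * (μ - b)) := by
  simp only [Module.End.mem_eigenspace_iff, LinearMap.add_apply, LinearMap.smul_apply,
    Module.End.one_apply]
  rw [mul_smul, ← eq_sub_iff_add_eq, ← sub_smul, eq_inv_smul_iff₀ ha]

theorem eigenspace_affine (A : Module.End K V) {a : K} (ha : a ≠ 0) (b μ : K) :
    (a • A + b • (1 : Module.End K V)).eigenspace μ = A.eigenspace (a⁻¹ * (μ - b)) :=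
  Submodule.ext fun x => mem_eigenspace_affine A ha b μ x

theorem hasEigenvalue_affine (A : Module.End K V) {a : K} (ha : a ≠ 0) (b μ : K) :
    (a • A + b • (1 : Module.End K V)).HasEigenvalue μ ↔ A.HasEigenvalue (a⁻¹ * (μ - b)) := by
  rw [Module.End.hasEigenvalue_iff, Module.End.hasEigenvalue_iff, eigenspace_affine A ha]

theorem MultiplicityFree.affine {A : Module.End K V} (h : MultiplicityFree A) {a : K}
    (ha : a ≠ 0) (b : K) : MultiplicityFree (a • A + b • (1 : Module.End K V)) := by
  refine ⟨?_, fun μ hμ => ?_⟩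
  · rw [eq_top_iff, ← h.1]
    refine iSup_le fun μ => ?_
    refine le_trans (le_of_eq ?_) (le_iSup _ (a * μ + b))
    rw [eigenspace_affine A ha, add_sub_cancel_right, inv_mul_cancel_left₀ ha]
  · rw [eigenspace_affine A ha]
    exact h.2 _ ((hasEigenvalue_affine A ha b μ).1 hμ)

theorem IsIdempotentOrdering.affine {d : ℕ} {A : Module.End K V}
    {E : Fin (d + 1) → Module.End K V} (h : IsIdempotentOrdering A E) {a : K} (ha : a ≠ 0)
    (b : K) : IsIdempotentOrdering (a • A + b • (1 : Module.End K V)) E := by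
  obtain ⟨θ, hinj, hev, hE⟩ := h
  have key : ∀ s t : K, s = a⁻¹ * (t - b) ↔ a * s + b = t := by
    intro s t
    rw [eq_inv_mul_iff_mul_eq₀ ha, eq_sub_iff_add_eq]
  refine ⟨fun i => a * θ i + b, fun i j hij => ?_, fun μ => ?_, fun i => ⟨fun x hx => ?_, ?_⟩⟩
  · exact hinj (mul_left_cancel₀ ha (add_right_cancel hij))
  · rw [hasEigenvalue_affine A ha, hev]
    exact exists_congr fun i => key _ _
  · rw [eigenspace_affine A ha, ← (key (θ i) _).2 rfl] at hx
    exact (hE i).1 x hx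
  · intro ν hν x hx
    rw [eigenspace_affine A ha] at hx
    exact (hE i).2 _ (fun h => hν ((key _ _).1 h.symm).symm) x hx

theorem IsIdempotentOrdering.mul_eq_zero {d : ℕ} {A : Module.End K V}
    {E : Fin (d + 1) → Module.End K V} (hA : MultiplicityFree A) (h : IsIdempotentOrdering A E)
    {i j : Fin (d + 1)} (hij : i ≠ j) : E i * E j = 0 := by
  obtain ⟨θ, hinj, -, hE⟩ := h
  rw [← LinearMap.ker_eq_top, eq_top_iff, ← hA.1]
  refine iSup_le fun μ x hx => ?_
  rw [LinearMap.mem_ker, Module.End.mul_apply]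
  by_cases hμ : μ = θ j
  · subst hμ
    rw [(hE j).1 x hx]
    exact (hE i).2 _ (fun h => hij (hinj h.symm)) x hx
  · rw [(hE j).2 μ hμ x hx, map_zero]

theorem HessenbergWrt.affine {d : ℕ} {A B : Module.End K V} {E : Fin (d + 1) → Module.End K V}
    (hA : MultiplicityFree A) (hE : IsIdempotentOrdering A E) (h : HessenbergWrt E B) {a : K}
    (ha : a ≠ 0) (b : K) : HessenbergWrt E (a • B + b • (1 : Module.End K V)) := by
  intro i j
  have key : i ≠ j → E i * (a • B + b • (1 : Module.End K V)) * E j = a • (E i * B * E j) := by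
    intro hij
    simp [mul_add, add_mul, IsIdempotentOrdering.mul_eq_zero hA hE hij]
  refine ⟨fun hlt => ?_, fun heq => ?_⟩
  · rw [key (by rintro rfl; omega), (h i j).1 hlt, smul_zero]
  · rw [key (by rintro rfl; omega)]
    exact smul_ne_zero ha ((h i j).2 heq)

/-- The affine transformation `(a A + b I; {E i}; a' A' + b' I; {E' i})` of a TH system
associated with scalars `a, b, a', b'`, where `a` and `a'` are nonzero. -/
def THSystem.affineTransformation {d : ℕ} (Φ : THSystem K V d) (a b a' b' : K)
    (ha : a ≠ 0) (ha' : a' ≠ 0) : THSystem K V d where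
  A := a • Φ.A + b • (1 : Module.End K V)
  E := Φ.E
  A' := a' • Φ.A' + b' • (1 : Module.End K V)
  E' := Φ.E'
  isTHSystem :=
    { finrank_eq := Φ.isTHSystem.finrank_eq
      multiplicityFree := Φ.isTHSystem.multiplicityFree.affine ha b
      multiplicityFree' := Φ.isTHSystem.multiplicityFree'.affine ha' b'
      ordering := Φ.isTHSystem.ordering.affine ha b
      ordering' := Φ.isTHSystem.ordering'.affine ha' b'
      hessenberg := Φ.isTHSystem.hessenberg.affine Φ.isTHSystem.multiplicityFree
        Φ.isTHSystem.ordering ha' b'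
      hessenberg' := Φ.isTHSystem.hessenberg'.affine Φ.isTHSystem.multiplicityFree'
        Φ.isTHSystem.ordering' ha b }

/-- The reduction `({E i}; {E' i})` of a TH system. -/
def THSystem.reduction {d : ℕ} (Φ : THSystem K V d) : RTHSystem K V d where
  E := Φ.E
  E' := Φ.E'
  exists_isTHSystem := ⟨Φ.A, Φ.A', Φ.isTHSystem⟩

end Affine

section Isomorphism

variable {K : Type u} {V : Type v} {W : Type w} [Field K] [AddCommGroup V] [Module K V]
  [AddCommGroup W] [Module K W] {d : ℕ}

/-- Isomorphism of TH systems: some `K`-algebra isomorphism `End V → End W` carries each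
component of `Φ` to the corresponding component of `Ψ`. -/
def THSystem.Isomorphic (Φ : THSystem K V d) (Ψ : THSystem K W d) : Prop :=
  ∃ γ : Module.End K V ≃ₐ[K] Module.End K W,
    γ Φ.A = Ψ.A ∧ γ Φ.A' = Ψ.A' ∧ (∀ i, γ (Φ.E i) = Ψ.E i) ∧ ∀ i, γ (Φ.E' i) = Ψ.E' i

/-- Isomorphism of RTH systems. -/
def RTHSystem.Isomorphic (Λ : RTHSystem K V d) (Ω : RTHSystem K W d) : Prop :=
  ∃ γ : Module.End K V ≃ₐ[K] Module.End K W,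
    (∀ i, γ (Λ.E i) = Ω.E i) ∧ ∀ i, γ (Λ.E' i) = Ω.E' i

/-- `Φ` and `Ψ` are affine isomorphic: `Φ` is isomorphic to an affine transformation of `Ψ`. -/
def THSystem.AffineIsomorphic (Φ : THSystem K V d) (Ψ : THSystem K W d) : Prop :=
  ∃ (a b a' b' : K) (ha : a ≠ 0) (ha' : a' ≠ 0),
    Φ.Isomorphic (Ψ.affineTransformation a b a' b' ha ha')

end Isomorphism

/-- A TH system over `K` of diameter `d`, together with its underlying vector space. -/
structure THSystemOver (K : Type u) [Field K] (d : ℕ) where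
  V : Type v
  [addCommGroup : AddCommGroup V]
  [module : Module K V]
  sys : THSystem K V d

/-- An RTH system over `K` of diameter `d`, together with its underlying vector space. -/
structure RTHSystemOver (K : Type u) [Field K] (d : ℕ) where
  V : Type v
  [addCommGroup : AddCommGroup V]
  [module : Module K V]
  sys : RTHSystem K V d

attribute [instance] THSystemOver.addCommGroup THSystemOver.module
attribute [instance] RTHSystemOver.addCommGroup RTHSystemOver.module

/-- The map sending a TH system over `K` to its reduction. -/
def THSystemOver.reduction {K : Type u} [Field K] {d : ℕ} (Φ : THSystemOver.{u, v} K d) :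
    RTHSystemOver.{u, v} K d where
  V := Φ.V
  sys := Φ.sys.reduction

/-- Affine isomorphism, as an equivalence relation on the TH systems over `K` of diameter `d`. -/
def affineSetoid (K : Type u) [Field K] (d : ℕ) : Setoid (THSystemOver.{u, v} K d) where
  r Φ Ψ := Φ.sys.AffineIsomorphic Ψ.sys
  iseqv :=
    { refl := fun Φ => ⟨1, 0, 1, 0, one_ne_zero, one_ne_zero, AlgEquiv.refl, by
        simp [THSystem.affineTransformation]⟩
      symm := by
        rintro Φ Ψ ⟨a, b, a', b', ha, ha', γ, hA, hA', hE, hE'⟩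
        refine ⟨a⁻¹, -(a⁻¹ * b), a'⁻¹, -(a'⁻¹ * b'), inv_ne_zero ha, inv_ne_zero ha', γ.symm,
          ?_, ?_, fun i => ?_, fun i => ?_⟩
        · rw [AlgEquiv.symm_apply_eq]
          simp [THSystem.affineTransformation, hA, smul_smul, ha]
        · rw [AlgEquiv.symm_apply_eq]
          simp [THSystem.affineTransformation, hA', smul_smul, ha']
        · rw [AlgEquiv.symm_apply_eq]
          exact (hE i).symm
        · rw [AlgEquiv.symm_apply_eq]
          exact (hE' i).symm
      trans := by
        rintro Φ Ψ X ⟨a, b, a', b', ha, ha', γ, hA, hA', hE, hE'⟩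
          ⟨c, e, c', e', hc, hc', δ, kA, kA', kE, kE'⟩
        refine ⟨a * c, a * e + b, a' * c', a' * e' + b', mul_ne_zero ha hc, mul_ne_zero ha' hc',
          γ.trans δ, ?_, ?_, fun i => ?_, fun i => ?_⟩
        · simp [THSystem.affineTransformation, hA, kA, smul_smul, add_smul, add_assoc]
        · simp [THSystem.affineTransformation, hA', kA', smul_smul, add_smul, add_assoc]
        · rw [AlgEquiv.trans_apply, hE]
          exact kE i
        · rw [AlgEquiv.trans_apply, hE']
          exact kE' i }

/-- Isomorphism, as an equivalence relation on the RTH systems over `K` of diameter `d`. -/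
def reducedSetoid (K : Type u) [Field K] (d : ℕ) : Setoid (RTHSystemOver.{u, v} K d) where
  r Λ Ω := Λ.sys.Isomorphic Ω.sys
  iseqv :=
    { refl := fun Λ => ⟨AlgEquiv.refl, fun _ => rfl, fun _ => rfl⟩
      symm := by
        rintro Λ Ω ⟨γ, h, h'⟩
        exact ⟨γ.symm, fun i => by rw [← h, AlgEquiv.symm_apply_apply],
          fun i => by rw [← h', AlgEquiv.symm_apply_apply]⟩
      trans := by
        rintro Λ Ω X ⟨γ, h, h'⟩ ⟨δ, k, k'⟩
        exact ⟨γ.trans δ, fun i => by rw [AlgEquiv.trans_apply, h, k],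
          fun i => by rw [AlgEquiv.trans_apply, h', k']⟩ }

/-- The set of affine isomorphism classes of TH systems over `K` of diameter `d`. -/
def AffineClasses (K : Type u) [Field K] (d : ℕ) : Type (max u (v + 1)) :=
  Quotient (affineSetoid.{u, v} K d)

/-- The set of isomorphism classes of RTH systems over `K` of diameter `d`. -/
def ReducedClasses (K : Type u) [Field K] (d : ℕ) : Type (max u (v + 1)) :=
  Quotient (reducedSetoid.{u, v} K d)

/-- The affine isomorphism class of a TH system. -/
def affineClass {K : Type u} [Field K] {d : ℕ} (Φ : THSystemOver.{u, v} K d) :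
    AffineClasses.{u, v} K d :=
  Quotient.mk (affineSetoid K d) Φ

/-- The isomorphism class of an RTH system. -/
def reducedClass {K : Type u} [Field K] {d : ℕ} (Λ : RTHSystemOver.{u, v} K d) :
    ReducedClasses.{u, v} K d :=
  Quotient.mk (reducedSetoid K d) Λ

end ThinHessenberg

/-! The substance is that the idempotents determine `A` and `A'` up to affine change. Let `γ` carry
the idempotents of one TH system to those `F`, `F'` of another, whose first operator is `B`. Since
`A` is a combination of the `E i`, `γ A` is a combination of the `F i`, hence a polynomial `p` in
`B` of degree at most `d`, by Lagrange interpolation at the distinct eigenvalues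
(`IsTHSystem.exists_eq_affine`). Both `B` and `p(B)` are Hessenberg with respect to `F'`. For `v ≠
0` fixed by `F' 0`, each application of `B` reaches exactly one index further
(`HessenbergWrt.exists_pow_apply`), so `p(B) v` has a nonzero component at index `deg p`. The
Hessenberg shape of `p(B)` forbids this when `deg p > 1`, so `p` is affine. -/

namespace ThinHessenberg

/-! ### Spectral decomposition and polynomials in a multiplicity-free map -/

section Idempotents

variable {K : Type u} {V : Type v} [Field K] [AddCommGroup V] [Module K V] {d : ℕ}
  {A : Module.End K V} {E : Fin (d + 1) → Module.End K V} {θ : Fin (d + 1) → K}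

/-- Endomorphisms agreeing on the eigenspaces of a diagonalizable endomorphism are equal. -/
theorem MultiplicityFree.hom_ext (hA : MultiplicityFree A)
    (hev : ∀ μ : K, A.HasEigenvalue μ ↔ ∃ i, θ i = μ) {f g : Module.End K V}
    (h : ∀ j, ∀ x ∈ A.eigenspace (θ j), f x = g x) : f = g := by
  rw [← sub_eq_zero, ← LinearMap.ker_eq_top, eq_top_iff, ← hA.1]
  refine iSup_le fun μ x hx => ?_
  rw [LinearMap.mem_ker, LinearMap.sub_apply, sub_eq_zero]
  by_cases hμ : A.HasEigenvalue μ
  · obtain ⟨j, rfl⟩ := (hev μ).1 hμ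
    exact h j x hx
  · rw [Module.End.hasEigenvalue_iff, not_not] at hμ
    rw [hμ, Submodule.mem_bot] at hx
    simp [hx]

theorem IsPrimitiveIdempotent.apply_of_mem_eigenspace (hinj : Function.Injective θ)
    (hE : ∀ i, IsPrimitiveIdempotent A (θ i) (E i)) (i j : Fin (d + 1)) {x : V}
    (hx : x ∈ A.eigenspace (θ j)) : E i x = if i = j then x else 0 := by
  split_ifs with h
  · subst h
    exact (hE i).1 x hx
  · exact (hE i).2 _ (fun h' => h (hinj h').symm) x hx

/-- The spectral data of an ordering of primitive idempotents. -/
theorem IsIdempotentOrdering.exists_spectrum (hA : MultiplicityFree A)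
    (h : IsIdempotentOrdering A E) :
    ∃ θ : Fin (d + 1) → K, Function.Injective θ ∧ (∀ i, A.HasEigenvalue (θ i)) ∧
      (∀ i, ∀ x ∈ A.eigenspace (θ i), E i x = x) ∧
      (∀ i x, E i x ∈ A.eigenspace (θ i)) ∧ ∑ i, E i = 1 := by
  obtain ⟨θ, hinj, hev, hE⟩ := h
  refine ⟨θ, hinj, fun i => (hev _).2 ⟨i, rfl⟩, fun i => (hE i).1, fun i x => ?_, ?_⟩
  · rw [Module.End.mem_eigenspace_iff]
    have key : A * E i = θ i • E i := by
      refine hA.hom_ext hev fun j x hx => ?_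
      rw [Module.End.mul_apply, LinearMap.smul_apply,
        IsPrimitiveIdempotent.apply_of_mem_eigenspace hinj hE i j hx]
      split_ifs with hij
      · subst hij
        exact Module.End.mem_eigenspace_iff.1 hx
      · simp
    exact LinearMap.congr_fun key x
  · refine hA.hom_ext hev fun j x hx => ?_
    simp [LinearMap.sum_apply, IsPrimitiveIdempotent.apply_of_mem_eigenspace hinj hE _ j hx]

/-- Multiply `∑ i, E i = 1` by `p(A)`, which acts on the range of `E i` as `p(θ i)`. Taking `p = X`
decomposes `A`; an interpolating `p` turns any combination of the `E i` into a polynomial in `A`. -/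
theorem aeval_eq_sum_of_range_le_eigenspace (hr : ∀ i x, E i x ∈ A.eigenspace (θ i))
    (hsum : ∑ i, E i = 1) (p : Polynomial K) :
    Polynomial.aeval A p = ∑ i, p.eval (θ i) • E i := by
  rw [← mul_one (Polynomial.aeval A p), ← hsum, Finset.mul_sum]
  refine Finset.sum_congr rfl fun i _ => LinearMap.ext fun x => ?_
  exact Module.End.aeval_apply_of_mem_apply_eq_smul (Module.End.mem_eigenspace_iff.1 (hr i x))

/-- A multiplicity-free endomorphism is a linear combination of its primitive idempotents. -/
theorem IsIdempotentOrdering.exists_eq_sum (hA : MultiplicityFree A)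
    (h : IsIdempotentOrdering A E) : ∃ η : Fin (d + 1) → K, A = ∑ i, η i • E i := by
  obtain ⟨θ, -, -, -, hr, hsum⟩ := h.exists_spectrum hA
  refine ⟨θ, ?_⟩
  simpa using aeval_eq_sum_of_range_le_eigenspace hr hsum Polynomial.X

end Idempotents

/-! ### Rigidity of the Hessenberg shape -/

section Hessenberg

variable {K : Type u} {V : Type v} [Field K] [AddCommGroup V] [Module K V] {d : ℕ}
  {A A' : Module.End K V} {E E' : Fin (d + 1) → Module.End K V}

theorem IsTHSystem.swap (h : IsTHSystem A E A' E') : IsTHSystem A' E' A E :=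
  ⟨h.finrank_eq, h.multiplicityFree', h.multiplicityFree, h.ordering', h.ordering,
    h.hessenberg', h.hessenberg⟩

/-- If `P` takes values in a line and `F * P ≠ 0`, then `F` is injective on the range of `P`. -/
theorem apply_ne_zero_of_mul_ne_zero {S : Submodule K V} (hS : Module.finrank K S = 1)
    {P F : Module.End K V} (hP : ∀ x, P x ∈ S) (hF : F * P ≠ 0) {x : V} (hx : P x ≠ 0) :
    F (P x) ≠ 0 := by
  intro h0
  refine hF (LinearMap.ext fun y => ?_)
  -- `P x` spans the line `S`, so `F (P x) = 0` would kill every `P y`.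
  obtain ⟨c, hc⟩ := (finrank_eq_one_iff_of_nonzero' (⟨P x, hP x⟩ : S)
    (fun h => hx (congrArg Subtype.val h))).1 hS ⟨P y, hP y⟩
  have hc' : c • P x = P y := congrArg Subtype.val hc
  simp [← hc', h0]

/-- Powers of an endomorphism in Hessenberg form, applied to the first eigenvector of `A'`. -/
theorem HessenbergWrt.exists_pow_apply (hA' : MultiplicityFree A')
    (hE' : IsIdempotentOrdering A' E') (h : HessenbergWrt E' A) :
    ∃ v : V, E' 0 v = v ∧ ∀ k : ℕ,
      (∀ i : Fin (d + 1), k < i → E' i ((A ^ k) v) = 0) ∧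
      ∀ i : Fin (d + 1), (i : ℕ) = k → E' i ((A ^ k) v) ≠ 0 := by
  obtain ⟨θ, -, hev, hid, hr, hsum⟩ := hE'.exists_spectrum hA'
  obtain ⟨v, hv, hv0⟩ := (hev 0).exists_hasEigenvector
  have hvv : E' 0 v = v := hid 0 v hv
  refine ⟨v, hvv, fun k => ?_⟩
  induction k with
  | zero =>
    refine ⟨fun i hi => ?_, fun i hi => ?_⟩
    · have hi0 : i ≠ 0 := by rintro rfl; simp at hi
      rw [pow_zero, Module.End.one_apply, ← hvv]
      exact LinearMap.congr_fun (hE'.mul_eq_zero hA' hi0) v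
    · obtain rfl : i = 0 := Fin.ext hi
      rwa [pow_zero, Module.End.one_apply, hvv]
  | succ k ih =>
    -- Insert `∑ j, E' j = 1` between `A` and `A ^ k`.
    have expand : ∀ i, E' i ((A ^ (k + 1)) v) = ∑ j, (E' i * A * E' j) ((A ^ k) v) := by
      intro i
      rw [← LinearMap.sum_apply, ← Finset.mul_sum, hsum, mul_one, pow_succ']
      rfl
    -- Terms with `j < k` die by the Hessenberg shape, those with `j > k` by induction; at `i = k +
    -- 1` only `j = k` is left.
    have vanish : ∀ i j : Fin (d + 1), k < i → (i : ℕ) ≠ j + 1 →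
        (j : ℕ) ≠ k → (E' i * A * E' j) ((A ^ k) v) = 0 := by
      intro i j hi hij hj
      rcases lt_or_gt_of_ne hj with hjk | hjk
      · rw [(h i j).1 (by omega), LinearMap.zero_apply]
      · rw [Module.End.mul_apply, ih.1 j hjk, map_zero]
    refine ⟨fun i hi => ?_, fun i hi => ?_⟩
    · rw [expand]
      refine Finset.sum_eq_zero fun j _ => ?_
      rcases le_or_gt (j : ℕ) k with hjk | hjk
      · rw [(h i j).1 (by omega), LinearMap.zero_apply]
      · rw [Module.End.mul_apply, ih.1 j hjk, map_zero]
    · let l : Fin (d + 1) := ⟨k, by omega⟩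
      have hl : (i : ℕ) = l + 1 := hi
      rw [expand, Finset.sum_eq_single l
        (fun j _ hj => vanish i j (by omega) (fun hij => hj (Fin.ext (by omega)))
          (fun hjk => hj (Fin.ext hjk))) (by simp)]
      exact apply_ne_zero_of_mul_ne_zero (hA'.2 _ (hev l)) (hr l) ((h i l).2 hl) (ih.2 l rfl)

/-- A Hessenberg linear combination of the idempotents `E i` of a TH system is an affine
function of `A`. -/
theorem IsTHSystem.exists_eq_affine (h : IsTHSystem A E A' E') {C : Module.End K V}
    {η : Fin (d + 1) → K} (hC : C = ∑ i, η i • E i) (hH : HessenbergWrt E' C) :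
    ∃ a b : K, a ≠ 0 ∧ C = a • A + b • (1 : Module.End K V) := by
  classical
  obtain ⟨θ, hinj, -, -, hr, hsum⟩ := h.ordering.exists_spectrum h.multiplicityFree
  set p : Polynomial K := Lagrange.interpolate Finset.univ θ η with hp
  have hpC : Polynomial.aeval A p = C := by
    rw [aeval_eq_sum_of_range_le_eigenspace hr hsum, hC]
    refine Finset.sum_congr rfl fun i _ => ?_
    rw [hp, Lagrange.eval_interpolate_at_node _ hinj.injOn (Finset.mem_univ i)]
  have hdeg : p.natDegree < d + 1 := by
    rcases eq_or_ne p 0 with h0 | h0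
    · simp [h0]
    · have := Lagrange.degree_interpolate_lt (s := Finset.univ) η hinj.injOn
      rw [← hp, Finset.card_univ, Fintype.card_fin] at this
      exact (Polynomial.natDegree_lt_iff_degree_lt h0).2 this
  obtain ⟨v, hv, hpow⟩ := h.hessenberg'.exists_pow_apply h.multiplicityFree' h.ordering'
  have hle : p.natDegree ≤ 1 := by
    by_contra! hlt
    -- At index `deg p > 1` the Hessenberg shape of `C` gives zero, while among the powers of `A` in
    -- `p(A) v` only the top one contributes, and not by zero.
    let k : Fin (d + 1) := ⟨p.natDegree, hdeg⟩
    have hzero : E' k (C v) = 0 := by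
      have := LinearMap.congr_fun ((hH k 0).1 (by simpa [k] using hlt)) v
      simpa [hv] using this
    rw [← hpC, Polynomial.aeval_eq_sum_range, LinearMap.sum_apply, map_sum,
      Finset.sum_range_succ, Finset.sum_eq_zero, zero_add, LinearMap.smul_apply, map_smul,
      smul_eq_zero] at hzero
    · refine hzero.elim (fun h0 => ?_) ((hpow p.natDegree).2 k rfl)
      rw [Polynomial.coeff_natDegree, Polynomial.leadingCoeff_eq_zero] at h0
      simp [h0] at hlt
    · intro m hm
      rw [LinearMap.smul_apply, map_smul, (hpow m).1 k (Finset.mem_range.1 hm), smul_zero]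
  have hform : C = p.coeff 1 • A + p.coeff 0 • (1 : Module.End K V) := by
    rw [← hpC]
    conv_lhs => rw [Polynomial.eq_X_add_C_of_natDegree_le_one hle]
    simp [Algebra.smul_def]
  by_cases ha : p.coeff 1 = 0
  · rcases Nat.eq_zero_or_pos d with rfl | hd
    -- For `d = 0` the map `A` is itself scalar, so the slope is free and is taken to be `1`.
    · refine ⟨1, p.coeff 0 - θ 0, one_ne_zero, ?_⟩
      have hA : A = θ 0 • (1 : Module.End K V) := by
        rw [← hsum]
        simpa using aeval_eq_sum_of_range_le_eigenspace hr hsum Polynomial.X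
      rw [hform, ha, hA]
      module
    -- For `d > 0` a scalar `C` would have zero `(1, 0)` entry.
    · refine absurd ?_ ((hH ⟨1, by omega⟩ 0).2 rfl)
      rw [hform, ha, zero_smul, zero_add, mul_smul_comm, mul_one, smul_mul_assoc,
        h.ordering'.mul_eq_zero h.multiplicityFree' (by simp [Fin.ext_iff]), smul_zero]
  · exact ⟨_, _, ha, hform⟩

end Hessenberg

/-! ### Transport along algebra isomorphisms -/

section Transport

variable {K : Type u} {V : Type v} {W : Type w} [Field K] [AddCommGroup V] [Module K V]
  [AddCommGroup W] [Module K W] {d : ℕ}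

theorem HessenbergWrt.map {E : Fin (d + 1) → Module.End K V} {B : Module.End K V}
    {F : Fin (d + 1) → Module.End K W} (h : HessenbergWrt E B)
    (γ : Module.End K V ≃ₐ[K] Module.End K W) (hγ : ∀ i, γ (E i) = F i) :
    HessenbergWrt F (γ B) := by
  intro i j
  rw [← hγ, ← hγ, ← map_mul, ← map_mul, ne_eq, map_eq_zero_iff γ γ.injective]
  exact h i j

/-- An isomorphism carrying the idempotents of one TH system to those of another carries `A` to
an affine function of its counterpart. -/
theorem IsTHSystem.exists_map_eq_affine {A A' : Module.End K V}
    {E E' : Fin (d + 1) → Module.End K V} {B B' : Module.End K W}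
    {F F' : Fin (d + 1) → Module.End K W} (h : IsTHSystem A E A' E') (k : IsTHSystem B F B' F')
    (γ : Module.End K V ≃ₐ[K] Module.End K W) (hγ : ∀ i, γ (E i) = F i)
    (hγ' : ∀ i, γ (E' i) = F' i) :
    ∃ a b : K, a ≠ 0 ∧ γ A = a • B + b • (1 : Module.End K W) := by
  obtain ⟨η, hη⟩ := h.ordering.exists_eq_sum h.multiplicityFree
  refine k.exists_eq_affine (η := η) ?_ (h.hessenberg'.map γ hγ')
  rw [hη, map_sum]
  simp [hγ]

/-- The two halves of a TH system play symmetric roles, so the statement for `A` applied to the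
swapped systems handles `A'`, with the same `γ`. -/
theorem THSystem.reduction_isomorphic_iff (Φ : THSystem K V d) (Ψ : THSystem K W d) :
    Φ.reduction.Isomorphic Ψ.reduction ↔ Φ.AffineIsomorphic Ψ := by
  constructor
  · rintro ⟨γ, hγ, hγ'⟩
    obtain ⟨a, b, ha, hA⟩ := Φ.isTHSystem.exists_map_eq_affine Ψ.isTHSystem γ hγ hγ'
    obtain ⟨a', b', ha', hA'⟩ :=
      Φ.isTHSystem.swap.exists_map_eq_affine Ψ.isTHSystem.swap γ hγ' hγ
    exact ⟨a, b, a', b', ha, ha', γ, hA, hA', hγ, hγ'⟩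
  · rintro ⟨a, b, a', b', ha, ha', γ, -, -, hγ, hγ'⟩
    exact ⟨γ, hγ, hγ'⟩

end Transport

end ThinHessenberg

theorem corollary19p6 (K : Type u) [Field K] (d : ℕ) :
    (∀ (V : Type v) [AddCommGroup V] [Module K V] (W : Type w) [AddCommGroup W] [Module K W]
        (Φ : ThinHessenberg.THSystem K V d) (Φ' : ThinHessenberg.THSystem K W d),
        Φ.reduction.Isomorphic Φ'.reduction ↔ Φ.AffineIsomorphic Φ') ∧
    ∃ f : ThinHessenberg.AffineClasses.{u, v} K d → ThinHessenberg.ReducedClasses.{u, v} K d,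
      (∀ Φ : ThinHessenberg.THSystemOver.{u, v} K d,
        f (ThinHessenberg.affineClass Φ) = ThinHessenberg.reducedClass Φ.reduction) ∧
      Function.Bijective f := by
  refine ⟨fun V _ _ W _ _ Φ Φ' => Φ.reduction_isomorphic_iff Φ',
    Quotient.lift (fun Φ => ThinHessenberg.reducedClass Φ.reduction) fun Φ Ψ h =>
      Quotient.sound ((Φ.sys.reduction_isomorphic_iff Ψ.sys).2 h), fun _ => rfl, ?_, ?_⟩
  · rintro ⟨Φ⟩ ⟨Ψ⟩ h
    exact Quotient.sound ((Φ.sys.reduction_isomorphic_iff Ψ.sys).1 (Quotient.exact h))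
  -- Surjectivity is built into the definition: an RTH system comes with some `A`, `A'` completing
  -- it.
  · rintro ⟨⟨V, E, E', A, A', h⟩⟩
    exact ⟨ThinHessenberg.affineClass ⟨V, ⟨A, E, A', E', h⟩⟩, rfl⟩
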